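/- **$L^1$-convergence of discrete optimal controls.** *Continuous problem.* Let $A\in\mathbb R^{n\times n}$, $B\in\mathbb R^{n\times m}$, $U=[-1,1]^m$, $\mathcal S=\{0\}$, $t_f>0$. For $t\ge 0$ let $\mathcal R(t)$ be the set of all $y_0\in\mathbb R^n$ for which there are a measurable $u:\mathbb R\to U$ and a solution of $\dot y=Ay+Bu$ a.e. on $[0,t]$, $y(0)=y_0$, with $y(t)=0$; let $T(y_0)=\inf\{t\ge 0: y_0\in\mathcal R(t)\}\in[0,\infty]$ be the minimum time function. Put $\bar A=-A$, $\bar B=-B$ (time-reversed system $\dot y=\bar Ay+\bar Bu$, $y(0)=0$). Assume that $\mathcal R(\cdot)$ is strictly expanding, $\mathcal R(s)\subset\operatorname{int}\mathcal R(t)$ for $0\le s<t\le t_f$, and that the normality condition $$\operatorname{rank}\{B\omega,AB\omega,\dots,A^{n-1}B\omega\}=n$$ holds for every nonzero vector $\omega$ along an edge of $U$ (if $m=1$, along the interval $U=[-1,1]$ itself). *Discretization.* Fix $K\ge 1$, $\Delta t=t_f/K$, $t_k=k\Delta t$. For $N\ge1$ let $h=\Delta t/N$, $t_{kj}=t_k+jh$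 ($0\le j\le N$). Consider a sequence of discretizations with $N\to\infty$ (i.e. $h\downarrow0$), each given by matrices $\Phi_h(t_{k'j'},t_{kj})$ for grid points $t_{kj}\le t_{k'j'}$ with $\Phi_h(t,t)=I$ and the semigroup property $\Phi_h(t,s)\Phi_h(s,r)=\Phi_h(t,r)$; weights $c_{kj}\ge0$; finite sets $S_{\mathcal R}^\Delta\subset\mathbb R^n$, $S_U^\Delta\subset\mathbb R^m$ of unit vectors; a set $\widetilde U_\Delta$ consisting of one supporting point of $U$ for each direction in $S_U^\Delta$; and sets $Y_{h\Delta}(t_k)$, where $Y_{h\Delta}(t_0)$ consists of supporting points of $\mathcal S=\{0\}$, and $Y_{h\Delta}(t_{k+1})$ consists of one (arbitrary) supporting point, for each direction in $S_{\mathcal R}^\Delta$, of the convex hull of $$\widetilde Y_{h\Delta}(t_{k+1})=\Phi_h(t_{k+1},t_k)Y_{h\Delta}(t_k)+h\sum_{j=0}^N c_{kj}\Phi_h(t_{k+1},t_{kj})\bar B\,\widetilde U_\Delta,\qquad k=0,\dots,K-1 .$$ Let $\mathcal R_{h\Delta}(t_k)=\operatorname{co}Y_{h\Delta}(t_k)$.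 Assume that for some constants $C$ and $p>0$ independent of $h$ one has $\|e^{(t_{k+1}-t_{kj})\bar A}-\Phi_h(t_{k+1},t_{kj})\|\le Ch^p$ for all $0\le k<K$, $0\le j\le N$. Fix $i\in\{1,\dots,K\}$ and assume that $\mathcal R_{h\Delta}(t_i)\to\mathcal R(t_i)$ in the Hausdorff distance as $h\downarrow 0$. *Controls.* Let $N_C(x)=\{v:\langle v,y-x\rangle\le0\ \forall y\in C\}$ ($x\in C$) denote the normal cone. Let $\hat y\in\mathcal R(t_i)$, $0\ne\zeta\in N_{\mathcal R(t_i)}(\hat y)$, let the row vector function $\eta$ solve $\dot\eta=-\eta\bar A$, $\eta(t_i)=\zeta$, and put $\hat u(t)=\operatorname{sign}(\eta(t)\bar B)^\top$ (componentwise, $\operatorname{sign}0=0$). Given $\hat y_h\in\mathcal R_{h\Delta}(t_i)$ and $\zeta_h\in N_{\mathcal R_{h\Delta}(t_i)}(\hat y_h)$, let $(\eta_{kj})$, $0\le k<i$, $0\le j\le N$, solve $$\eta_{k(j-1)}=\eta_{kj}\Phi_h(t_{kj},t_{k(j-1)}),\qquad \eta_{kN}=\eta_{(k+1)0},\qquad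 \eta_{(i-1)N}=\zeta_h,$$ and let $\hat u_h(t)=\operatorname{sign}(\eta_{kj}\bar B)^\top$ for $t\in[t_{kj},t_{k(j+1)})$, $0\le k<i$, $0\le j<N$, and $\hat u_h(t_i)=\operatorname{sign}(\eta_{(i-1)(N-1)}\bar B)^\top$. *Conclusion.* 1. $\hat u$ is an optimal control for $\hat y$: it is admissible, the solution of $\dot y=\bar Ay+\bar B\hat u$, $y(0)=0$ satisfies $y(t_i)=\hat y$, and $T(\hat y)=t_i$. 2. There are pairs $(\hat y_h,\zeta_h)$, with $\hat y_h\in\mathcal R_{h\Delta}(t_i)$ and $\zeta_h\in N_{\mathcal R_{h\Delta}(t_i)}(\hat y_h)$ for all sufficiently small $h$, such that $(\hat y_h,\zeta_h)\to(\hat y,\zeta)$ as $h\downarrow0$. 3. For every choice of pairs $(\hat y_h,\zeta_h)$ as in 2, $$\int_0^{t_i}\|\hat u(t)-\hat u_h(t)\|_1\,dt\longrightarrow0\qquad(h\downarrow0),$$ where $\|x\|_1=\sum_\mu|x_\mu|$. -/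

import Mathlib

open Filter Topology Set
open scoped Matrix

namespace MinTime

/-- Euclidean space `ℝⁿ` (states, adjoint row vectors and controls). -/
abbrev Vec (n : ℕ) : Type := EuclideanSpace ℝ (Fin n)

/-- Matrix times column vector. -/
noncomputable def mulV {a b : ℕ} (M : Matrix (Fin a) (Fin b) ℝ) (x : Vec b) : Vec a :=
  WithLp.toLp 2 (M *ᵥ x.ofLp)

/-- Row vector times matrix. -/
noncomputable def rowMul {a b : ℕ} (η : Vec a) (M : Matrix (Fin a) (Fin b) ℝ) : Vec b :=
  WithLp.toLp 2 (η.ofLp ᵥ* M)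

/-- The componentwise signum function. -/
noncomputable def signVec {m : ℕ} (v : Vec m) : Vec m :=
  WithLp.toLp 2 fun μ => Real.sign (v μ)

/-- The `ℓ₁`-norm. -/
noncomputable def norm1 {m : ℕ} (v : Vec m) : ℝ := ∑ μ, |v μ|

/-- The spectral norm of a square matrix. -/
noncomputable def specNorm {n : ℕ} (M : Matrix (Fin n) (Fin n) ℝ) : ℝ :=
  ‖Matrix.toEuclideanCLM (n := Fin n) (𝕜 := ℝ) M‖

/-- The control set `[-1,1]^m`. -/
def cube (m : ℕ) : Set (Vec m) := {u | ∀ μ, u μ ∈ Icc (-1 : ℝ) 1}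

/-! ### The continuous-time problem -/

/-- Admissible controls: measurable functions with values in `U`. -/
def IsAdmissible {m : ℕ} (U : Set (Vec m)) (u : ℝ → Vec m) : Prop :=
  Measurable u ∧ ∀ t, u t ∈ U

/-- `y` is the (Carathéodory) solution on `[0,t]` of `y' = A y + B u` a.e., `y(0) = y₀`,
written as the equivalent integral equation. -/
def IsTrajectory {n m : ℕ} (A : Matrix (Fin n) (Fin n) ℝ) (B : Matrix (Fin n) (Fin m) ℝ)
    (u : ℝ → Vec m) (y₀ : Vec n) (t : ℝ) (y : ℝ → Vec n) : Prop :=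
  ContinuousOn y (Icc 0 t) ∧
    ∀ s ∈ Icc 0 t, y s = y₀ + ∫ r in (0 : ℝ)..s, (mulV A (y r) + mulV B (u r))

/-- The (backward) reachable set `R(t)`: the starting points from which the target `S` can be
reached at time `t` along `y' = A y + B u`. -/
def reach {n m : ℕ} (A : Matrix (Fin n) (Fin n) ℝ) (B : Matrix (Fin n) (Fin m) ℝ)
    (U : Set (Vec m)) (S : Set (Vec n)) (t : ℝ) : Set (Vec n) :=
  {y₀ | ∃ u, IsAdmissible U u ∧ ∃ y, IsTrajectory A B u y₀ t y ∧ y t ∈ S}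

/-- The minimum time function `T(y₀) ∈ [0,∞]`: the infimum of all times at which some admissible
trajectory starting in `y₀` is in the target. -/
noncomputable def minTime {n m : ℕ} (A : Matrix (Fin n) (Fin n) ℝ) (B : Matrix (Fin n) (Fin m) ℝ)
    (U : Set (Vec m)) (S : Set (Vec n)) (y₀ : Vec n) : ENNReal :=
  sInf {τ | ∃ t : ℝ, 0 ≤ t ∧ y₀ ∈ reach A B U S t ∧ τ = ENNReal.ofReal t}

/-- `R(·)` is strictly expanding on `[0,t_f]`. -/
def StrictlyExpanding {n m : ℕ} (A : Matrix (Fin n) (Fin n) ℝ) (B : Matrix (Fin n) (Fin m) ℝ)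
    (U : Set (Vec m)) (S : Set (Vec n)) (tf : ℝ) : Prop :=
  ∀ t₁ t₂ : ℝ, 0 ≤ t₁ → t₁ < t₂ → t₂ ≤ tf →
    reach A B U S t₁ ⊆ interior (reach A B U S t₂)

/-- `ω` is a nonzero vector along an edge (a nondegenerate segment that is a face) of `U`.
For `U = [-1,1]` the only edge is `U` itself. -/
def IsAlongEdge {m : ℕ} (U : Set (Vec m)) (ω : Vec m) : Prop :=
  ∃ v w : Vec m, v ≠ w ∧ IsExtreme ℝ U (segment ℝ v w) ∧ ∃ c : ℝ, c ≠ 0 ∧ ω = c • (w - v)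

/-- Normality: `rank {B ω, A B ω, …, A^(n-1) B ω} = n` for every nonzero `ω` along an edge. -/
def IsNormal {n m : ℕ} (A : Matrix (Fin n) (Fin n) ℝ) (B : Matrix (Fin n) (Fin m) ℝ)
    (U : Set (Vec m)) : Prop :=
  ∀ ω, IsAlongEdge U ω →
    Module.finrank ℝ
      (Submodule.span ℝ (range fun k : Fin n => mulV (A ^ (k : ℕ) * B) ω)) = n

/-- The normal cone of convex analysis; empty at points outside `C`. -/
def normalCone {n : ℕ} (C : Set (Vec n)) (x : Vec n) : Set (Vec n) :=
  {v | x ∈ C ∧ ∀ y ∈ C, inner ℝ v (y - x) ≤ 0}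

/-- Solutions of the adjoint equation `η' = -η Abar`, `η(t_end) = ζ`. -/
def IsAdjoint {n : ℕ} (Abar : Matrix (Fin n) (Fin n) ℝ) (tend : ℝ) (ζ : Vec n)
    (η : ℝ → Vec n) : Prop :=
  (∀ t, HasDerivAt η (-(rowMul (η t) Abar)) t) ∧ η tend = ζ

/-- The control `û(t) = sign(η(t) Bbar)`. -/
noncomputable def signControl {n m : ℕ} (Bbar : Matrix (Fin n) (Fin m) ℝ) (η : ℝ → Vec n)
    (t : ℝ) : Vec m :=
  signVec (rowMul (η t) Bbar)

/-! ### The fully discrete algorithm -/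

/-- `P` consists of one supporting point of `C` for each direction in `dirs`. -/
def IsSupportSelection {n : ℕ} (dirs : Set (Vec n)) (C P : Set (Vec n)) : Prop :=
  ∃ f : Vec n → Vec n,
    (∀ l ∈ dirs, f l ∈ C ∧ ∀ x ∈ C, inner ℝ l x ≤ inner ℝ l (f l)) ∧ P = f '' dirs

/-- The data of one discretization. The time axis is divided into macro intervals of length `Δt`
and each of them into `N` steps of size `h = Δt / N`; the grid point `t_{kj} = k Δt + j h` has the
global index `k N + j`. -/
structure Discretization (n m : ℕ) where
  /-- number of steps per macro interval -/
  N : ℕ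
  N_pos : 0 < N
  /-- one-step transition matrices: `step q = Φ_h(τ_{q+1}, τ_q)` with `τ_q = q h` -/
  step : ℕ → Matrix (Fin n) (Fin n) ℝ
  /-- quadrature weights: `weight k j` belongs to `t_{kj}` on the `k`-th macro interval -/
  weight : ℕ → ℕ → ℝ
  weight_nonneg : ∀ k j, 0 ≤ weight k j
  /-- finitely many unit directions in the state space -/
  dirR : Finset (Vec n)
  dirR_unit : ∀ l ∈ dirR, ‖l‖ = 1
  /-- finitely many unit directions in the control space -/
  dirU : Finset (Vec m)
  dirU_unit : ∀ l ∈ dirU, ‖l‖ = 1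
  /-- the chosen supporting points of the control set -/
  Utilde : Set (Vec m)
  /-- the chosen supporting points `Y(t_k)` of the discrete reachable sets -/
  Y : ℕ → Set (Vec n)

/-- `Φ_h(τ_a, τ_b)` for `b ≤ a` (the identity for `a ≤ b`). -/
noncomputable def transition {n : ℕ} (step : ℕ → Matrix (Fin n) (Fin n) ℝ) :
    ℕ → ℕ → Matrix (Fin n) (Fin n) ℝ
  | 0, _ => 1
  | a + 1, b => if b ≤ a then step a * transition step a b else 1

/-- The semigroup property of `Φ_h`. -/
theorem transition_mul {n : ℕ} (step : ℕ → Matrix (Fin n) (Fin n) ℝ) {a b c : ℕ}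
    (hcb : c ≤ b) (hba : b ≤ a) :
    transition step a b * transition step b c = transition step a c := by
  induction a with
  | zero =>
    obtain rfl : b = 0 := by omega
    simp [transition]
  | succ a ih =>
    rcases Nat.lt_or_ge a b with hab | hab
    · obtain rfl : b = a + 1 := by omega
      simp [transition]
    · have hca : c ≤ a := hcb.trans hab
      simp only [transition, hab, hca, if_true, Matrix.mul_assoc, ih hab]

namespace Discretization

variable {n m : ℕ}

/-- The step size. -/
noncomputable def h (D : Discretization n m) (Δt : ℝ) : ℝ := Δt / D.N

/-- The grid point `t_{kj}`. -/
noncomputable def grid (D : Discretization n m) (Δt : ℝ) (k j : ℕ) : ℝ := k * Δt + j * D.h Δt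

/-- `Ỹ(t_{k+1}) = Φ_h(t_{k+1},t_k) Y(t_k) + h ∑_{j=0}^N c_{kj} Φ_h(t_{k+1},t_{kj}) Bbar Ũ`
(Minkowski sum). -/
def Ytilde (D : Discretization n m) (Bbar : Matrix (Fin n) (Fin m) ℝ) (Δt : ℝ) (k : ℕ) :
    Set (Vec n) :=
  {z | ∃ y ∈ D.Y k, ∃ u : ℕ → Vec m, (∀ j ≤ D.N, u j ∈ D.Utilde) ∧
    z = mulV (transition D.step ((k + 1) * D.N) (k * D.N)) y +
      D.h Δt • ∑ j ∈ Finset.range (D.N + 1),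
        D.weight k j • mulV (transition D.step ((k + 1) * D.N) (k * D.N + j) * Bbar) (u j)}

/-- The sets stored in `D` are produced by `K` steps of the algorithm: supporting points of the
control set `U`, of the target `S`, and of `co Ỹ(t_{k+1})` are selected in the given directions. -/
structure IsRun (D : Discretization n m) (Bbar : Matrix (Fin n) (Fin m) ℝ) (U : Set (Vec m))
    (S : Set (Vec n)) (Δt : ℝ) (K : ℕ) : Prop where
  control : IsSupportSelection (D.dirU : Set (Vec m)) U D.Utilde
  init : IsSupportSelection (D.dirR : Set (Vec n)) S (D.Y 0)
  next : ∀ k < K, IsSupportSelection (D.dirR : Set (Vec n))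
    (convexHull ℝ (D.Ytilde Bbar Δt k)) (D.Y (k + 1))

/-- The fully discrete reachable set `R_{hΔ}(t_k)`. -/
def reachSet (D : Discretization n m) (k : ℕ) : Set (Vec n) := convexHull ℝ (D.Y k)

/-- The ODE solver underlying `Φ_h` has error at most `ε` on each of the `K` macro intervals:
`‖Φ(t_{k+1},t_{kj}) - Φ_h(t_{k+1},t_{kj})‖ ≤ ε`, where `Φ(t,s) = exp((t-s) Abar)`. -/
def SolverError (D : Discretization n m) (Abar : Matrix (Fin n) (Fin n) ℝ) (Δt : ℝ) (K : ℕ)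
    (ε : ℝ) : Prop :=
  ∀ k < K, ∀ j ≤ D.N,
    specNorm (NormedSpace.exp ((D.grid Δt (k + 1) 0 - D.grid Δt k j) • Abar) -
      transition D.step ((k + 1) * D.N) (k * D.N + j)) ≤ ε

/-- Solutions `η_{kj}`, `0 ≤ k < i`, `0 ≤ j ≤ N`, of the discrete adjoint equation
`η_{k(j-1)} = η_{kj} Φ_h(t_{kj}, t_{k(j-1)})`, `η_{(i-1)N} = ζ`, where the indices `kN` and
`(k+1)0` denote the same grid point. -/
structure IsAdjoint (D : Discretization n m) (i : ℕ) (ζ : Vec n) (η : ℕ → ℕ → Vec n) : Prop where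
  back : ∀ k < i, ∀ j < D.N, η k j =
    rowMul (η k (j + 1)) (transition D.step (k * D.N + (j + 1)) (k * D.N + j))
  glue : ∀ k, k + 1 < i → η k D.N = η (k + 1) 0
  final : η (i - 1) D.N = ζ

/-- `u` is, on `[0,t_i]`, the piecewise constant control with the value
`û_{kj} = sign(η_{kj} Bbar)` on `[t_{kj}, t_{k(j+1)})` and `û_{(i-1)(N-1)}` at the end point. -/
structure IsSignControl (D : Discretization n m) (Bbar : Matrix (Fin n) (Fin m) ℝ) (Δt : ℝ)
    (i : ℕ) (η : ℕ → ℕ → Vec n) (u : ℝ → Vec m) : Prop where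
  piece : ∀ k < i, ∀ j < D.N, ∀ t ∈ Ico (D.grid Δt k j) (D.grid Δt k (j + 1)),
    u t = signVec (rowMul (η k j) Bbar)
  final : u (D.grid Δt (i - 1) D.N) = signVec (rowMul (η (i - 1) (D.N - 1)) Bbar)

end Discretization

end MinTime

open MinTime

/-! Optimality rests on the maximum principle. Time reversal turns `reach` into a forward reachable
set from 0, and along any trajectory ⟨ζ, z(T)⟩ = ∫⟨ηB̄, u⟩ (`IsAdjoint.inner_trajectory`). The sign
control maximises this integrand pointwise, while a control steering to ŷ maximises the integral
because ζ is normal there; so the integrands agree a.e. Normality makes every switching function a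
nonzero analytic function (`IsNormal.ae_switching_ne_zero`), whose zeros are negligible, and the two
controls coincide a.e. (`exists_trajectory_signControl`). A point with a nonzero normal is not
interior, so strict expansion excludes an earlier arrival (`minTime_eq`).

For the approximating pairs, project ŷ + ζ onto the discrete reachable set: the residual is a normal
at the projection, and Hausdorff convergence drives the projection to ŷ
(`exists_tendsto_normalCone`).

For the controls, the solver error is propagated backwards over the macro intervals. Their number is
fixed, so the discrete adjoints converge to η uniformly on the grid (`exists_adjoint_error`). At
a.e. time all switching components are nonzero and signs are locally constant there, so the controls
eventually coincide pointwise; dominated convergence concludes. -/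

namespace MinTime

open MeasureTheory

/-! ### Linear algebra of matrices acting on Euclidean spaces -/

/-- `mulV M` as a continuous linear map. -/
noncomputable def mulVL {a b : ℕ} (M : Matrix (Fin a) (Fin b) ℝ) : Vec b →L[ℝ] Vec a :=
  LinearMap.toContinuousLinearMap
    { toFun := mulV M
      map_add' := fun x y => by ext; simp [mulV, Matrix.mulVec_add]
      map_smul' := fun c x => by ext; simp [mulV, Matrix.mulVec_smul] }

theorem mulVL_apply {a b : ℕ} (M : Matrix (Fin a) (Fin b) ℝ) (x : Vec b) :
    mulVL M x = mulV M x := rfl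

theorem mulV_mul {a b c : ℕ} (M : Matrix (Fin a) (Fin b) ℝ) (M' : Matrix (Fin b) (Fin c) ℝ)
    (x : Vec c) : mulV (M * M') x = mulV M (mulV M' x) := by
  simp [mulV, Matrix.mulVec_mulVec]

theorem mulV_neg {a b : ℕ} (M : Matrix (Fin a) (Fin b) ℝ) (x : Vec b) :
    mulV (-M) x = -mulV M x := by
  ext; simp [mulV, Matrix.neg_mulVec]

theorem continuous_mulV {a b : ℕ} (M : Matrix (Fin a) (Fin b) ℝ) : Continuous (mulV M) :=
  (mulVL M).continuous

theorem rowMul_eq_mulV {a b : ℕ} (η : Vec a) (M : Matrix (Fin a) (Fin b) ℝ) :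
    rowMul η M = mulV Mᵀ η := by
  simp [rowMul, mulV, Matrix.mulVec_transpose]

theorem continuous_rowMul {a b : ℕ} (M : Matrix (Fin a) (Fin b) ℝ) :
    Continuous fun η : Vec a => rowMul η M := by
  simpa only [rowMul_eq_mulV] using continuous_mulV Mᵀ

theorem rowMul_mul {a b c : ℕ} (η : Vec a) (M : Matrix (Fin a) (Fin b) ℝ)
    (M' : Matrix (Fin b) (Fin c) ℝ) : rowMul η (M * M') = rowMul (rowMul η M) M' := by
  simp [rowMul, Matrix.vecMul_vecMul]

theorem rowMul_one {a : ℕ} (η : Vec a) : rowMul η (1 : Matrix (Fin a) (Fin a) ℝ) = η := by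
  simp [rowMul]

theorem rowMul_sub {a b : ℕ} (η : Vec a) (M M' : Matrix (Fin a) (Fin b) ℝ) :
    rowMul η (M - M') = rowMul η M - rowMul η M' := by
  ext; simp [rowMul, Matrix.vecMul_sub]

theorem sub_rowMul {a b : ℕ} (η η' : Vec a) (M : Matrix (Fin a) (Fin b) ℝ) :
    rowMul (η - η') M = rowMul η M - rowMul η' M := by
  ext; simp [rowMul, Matrix.sub_vecMul]

theorem inner_rowMul {a b : ℕ} (η : Vec a) (M : Matrix (Fin a) (Fin b) ℝ) (x : Vec b) :
    inner ℝ (rowMul η M) x = inner ℝ η (mulV M x) := by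
  simp only [EuclideanSpace.inner_eq_star_dotProduct, rowMul, mulV, star_trivial]
  rw [dotProduct_comm, dotProduct_comm (M *ᵥ _), Matrix.dotProduct_mulVec]

theorem rowMul_apply {a b : ℕ} (η : Vec a) (M : Matrix (Fin a) (Fin b) ℝ) (μ : Fin b) :
    rowMul η M μ = inner ℝ η (mulV M (EuclideanSpace.single μ 1)) := by
  rw [← inner_rowMul]
  simp [EuclideanSpace.inner_single_right]

theorem toEuclideanCLM_eq_mulV {n : ℕ} (M : Matrix (Fin n) (Fin n) ℝ) (x : Vec n) :
    Matrix.toEuclideanCLM (n := Fin n) (𝕜 := ℝ) M x = mulV M x := by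
  ext
  simp [mulV]

theorem norm_mulV_le {n : ℕ} (M : Matrix (Fin n) (Fin n) ℝ) (x : Vec n) :
    ‖mulV M x‖ ≤ specNorm M * ‖x‖ := by
  rw [← toEuclideanCLM_eq_mulV]
  exact ContinuousLinearMap.le_opNorm _ _

/-- Pairing ηM with itself moves M to the other side, so the norm of M bounds its transpose as well.
-/
theorem norm_rowMul_le {n : ℕ} (η : Vec n) (M : Matrix (Fin n) (Fin n) ℝ) :
    ‖rowMul η M‖ ≤ specNorm M * ‖η‖ := by
  have h0 : 0 ≤ specNorm M := norm_nonneg _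
  rcases (norm_nonneg (rowMul η M)).eq_or_lt with h | h
  · rw [← h]; positivity
  · have h1 : ‖rowMul η M‖ * ‖rowMul η M‖ ≤ (specNorm M * ‖η‖) * ‖rowMul η M‖ := by
      rw [← real_inner_self_eq_norm_mul_norm, inner_rowMul]
      calc _ ≤ ‖η‖ * ‖mulV M (rowMul η M)‖ := real_inner_le_norm _ _
        _ ≤ ‖η‖ * (specNorm M * ‖rowMul η M‖) := by gcongr; exact norm_mulV_le _ _
        _ = _ := by ring
    exact le_of_mul_le_mul_right h1 h

/-! ### The matrix exponential and the adjoint equation -/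

section OperatorExp

theorem operatorExp_zero {E : Type*} [NormedAddCommGroup E] [NormedSpace ℝ E] (a : E →L[ℝ] E) :
    NormedSpace.exp ((0 : ℝ) • a) = 1 := by
  rw [zero_smul, NormedSpace.exp_zero]

variable {E : Type*} [NormedAddCommGroup E] [NormedSpace ℝ E] [CompleteSpace E]

theorem hasDerivAt_operatorExp (a : E →L[ℝ] E) (s : ℝ) :
    HasDerivAt (fun s : ℝ => NormedSpace.exp (s • a)) (a * NormedSpace.exp (s • a)) s :=
  hasDerivAt_exp_smul_const' (𝕂 := ℝ) a s

theorem operatorExp_mul_neg (a : E →L[ℝ] E) (s : ℝ) :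
    NormedSpace.exp (s • a) * NormedSpace.exp ((-s) • a) = 1 := by
  let _ : NormedAlgebra ℚ (E →L[ℝ] E) := NormedAlgebra.restrictScalars ℚ ℝ _
  rw [← NormedSpace.exp_add_of_commute]
  · rw [neg_smul, add_neg_cancel, NormedSpace.exp_zero]
  · rw [neg_smul]; exact (Commute.refl _).neg_right

theorem analyticAt_operatorExp (a : E →L[ℝ] E) (s : ℝ) :
    AnalyticAt ℝ (fun s : ℝ => NormedSpace.exp (s • a)) s :=
  (NormedSpace.exp_analytic (𝕂 := ℝ) (s • a)).comp (f := fun s : ℝ => s • a)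
    (analyticAt_id.smul analyticAt_const)

end OperatorExp

theorem continuous_toEuclideanCLM {n : ℕ} :
    Continuous (Matrix.toEuclideanCLM (n := Fin n) (𝕜 := ℝ)) :=
  LinearMap.continuous_of_finiteDimensional
    (Matrix.toEuclideanCLM (n := Fin n) (𝕜 := ℝ)).toAlgEquiv.toLinearMap

theorem toEuclideanCLM_exp {n : ℕ} (M : Matrix (Fin n) (Fin n) ℝ) (s : ℝ) :
    Matrix.toEuclideanCLM (n := Fin n) (𝕜 := ℝ) (NormedSpace.exp (s • M)) =
      NormedSpace.exp (s • Matrix.toEuclideanCLM (n := Fin n) (𝕜 := ℝ) M) := by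
  -- The exponential depends only on the topology, so any submultiplicative matrix norm serves.
  let _ : NormedRing (Matrix (Fin n) (Fin n) ℝ) := Matrix.linftyOpNormedRing
  let _ : NormedAlgebra ℝ (Matrix (Fin n) (Fin n) ℝ) := Matrix.linftyOpNormedAlgebra
  let _ : NormedAlgebra ℚ (Matrix (Fin n) (Fin n) ℝ) := NormedAlgebra.restrictScalars ℚ ℝ _
  rw [← map_smul]
  exact NormedSpace.map_exp (Matrix.toEuclideanCLM (n := Fin n) (𝕜 := ℝ))
    continuous_toEuclideanCLM (s • M)

/-- The exponential `exp (s M)` as an operator on Euclidean space. -/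
noncomputable def expL {n : ℕ} (M : Matrix (Fin n) (Fin n) ℝ) (s : ℝ) : Vec n →L[ℝ] Vec n :=
  NormedSpace.exp (s • Matrix.toEuclideanCLM (n := Fin n) (𝕜 := ℝ) M)

theorem expL_apply {n : ℕ} (M : Matrix (Fin n) (Fin n) ℝ) (s : ℝ) (x : Vec n) :
    expL M s x = mulV (NormedSpace.exp (s • M)) x := by
  rw [expL, ← toEuclideanCLM_exp, toEuclideanCLM_eq_mulV]

theorem expL_zero {n : ℕ} (M : Matrix (Fin n) (Fin n) ℝ) : expL M 0 = 1 :=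
  operatorExp_zero _

theorem expL_comp_neg {n : ℕ} (M : Matrix (Fin n) (Fin n) ℝ) (s : ℝ) (x : Vec n) :
    expL M s (expL M (-s) x) = x :=
  congrArg (fun f : Vec n →L[ℝ] Vec n => f x)
    (operatorExp_mul_neg (Matrix.toEuclideanCLM (n := Fin n) (𝕜 := ℝ) M) s)

theorem hasDerivAt_expL {n : ℕ} (M : Matrix (Fin n) (Fin n) ℝ) (s : ℝ) :
    HasDerivAt (expL M)
      (Matrix.toEuclideanCLM (n := Fin n) (𝕜 := ℝ) M * expL M s) s :=
  hasDerivAt_operatorExp _ s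

theorem continuous_expL {n : ℕ} (M : Matrix (Fin n) (Fin n) ℝ) : Continuous (expL M) :=
  continuous_iff_continuousAt.2 fun s => (hasDerivAt_expL M s).continuousAt

theorem analyticAt_expL {n : ℕ} (M : Matrix (Fin n) (Fin n) ℝ) (s : ℝ) :
    AnalyticAt ℝ (expL M) s :=
  analyticAt_operatorExp _ s

theorem specNorm_exp {n : ℕ} (M : Matrix (Fin n) (Fin n) ℝ) (s : ℝ) :
    specNorm (NormedSpace.exp (s • M)) = ‖expL M s‖ := by
  rw [specNorm, toEuclideanCLM_exp, expL]

theorem IsAdjoint.continuous {n : ℕ} {M : Matrix (Fin n) (Fin n) ℝ} {T : ℝ} {ζ : Vec n}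
    {η : ℝ → Vec n} (hη : IsAdjoint M T ζ η) : Continuous η :=
  continuous_iff_continuousAt.2 fun t => (hη.1 t).continuousAt

/-- The adjoint equation cancels the derivative of the flow, so the pairing is constant in `s`. -/
theorem IsAdjoint.inner_expL {n : ℕ} {M : Matrix (Fin n) (Fin n) ℝ} {T : ℝ} {ζ : Vec n}
    {η : ℝ → Vec n} (hη : IsAdjoint M T ζ η) (s t : ℝ) (x : Vec n) :
    inner ℝ (η s) (expL M (s - t) x) = inner ℝ (η t) x := by
  have hd : ∀ r, HasDerivAt (fun r => inner ℝ (η r) (expL M (r - t) x)) 0 r := by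
    intro r
    have h1 : HasDerivAt (fun r => expL M (r - t) x) (mulV M (expL M (r - t) x)) r := by
      have h2 := ((hasDerivAt_expL M (r - t)).comp_sub_const r t).clm_apply
        (hasDerivAt_const r x)
      simpa [toEuclideanCLM_eq_mulV] using h2
    have h3 := (hη.1 r).inner ℝ h1
    have h4 : inner ℝ (η r) (mulV M (expL M (r - t) x)) +
        inner ℝ (-rowMul (η r) M) (expL M (r - t) x) = (0 : ℝ) := by
      rw [inner_neg_left, inner_rowMul, add_neg_cancel]
    rwa [h4] at h3
  have := is_const_of_deriv_eq_zero (fun r => (hd r).differentiableAt) (fun r => (hd r).deriv) s t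
  simpa [expL_zero] using this

theorem IsAdjoint.rowMul_exp {n : ℕ} {M : Matrix (Fin n) (Fin n) ℝ} {T : ℝ} {ζ : Vec n}
    {η : ℝ → Vec n} (hη : IsAdjoint M T ζ η) (s t : ℝ) :
    rowMul (η s) (NormedSpace.exp ((s - t) • M)) = η t := by
  refine ext_inner_right ℝ fun x => ?_
  rw [inner_rowMul, ← expL_apply, hη.inner_expL]

/-! ### Normality -/

/-- The edge used is the one on which all coordinates other than `μ` equal 1. -/
theorem isAlongEdge_cube_single {m : ℕ} (μ : Fin m) :
    IsAlongEdge (cube m) (EuclideanSpace.single μ 1) := by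
  set e : Vec m := EuclideanSpace.single μ 1 with he
  set v : Vec m := WithLp.toLp 2 fun ν => if ν = μ then -1 else 1 with hv
  set w : Vec m := WithLp.toLp 2 fun _ => 1 with hw
  have hvw : w - v = (2 : ℝ) • e := by
    ext ν
    by_cases h : ν = μ
    · subst h; simp [hv, hw, he]; norm_num
    · simp [hv, hw, he, h]
  have hseg : segment ℝ v w = {x | x μ ∈ Icc (-1 : ℝ) 1 ∧ ∀ ν, ν ≠ μ → x ν = 1} := by
    ext x
    rw [segment_eq_image', mem_image]
    constructor
    · rintro ⟨θ, ⟨h0, h1⟩, rfl⟩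
      simp only [hvw]
      refine ⟨?_, fun ν hν => ?_⟩
      · simp only [hv, he, PiLp.add_apply, PiLp.smul_apply, PiLp.single_apply, smul_eq_mul,
          if_true, mem_Icc]
        constructor <;> linarith
      · simp [hv, he, hν]
    · rintro ⟨⟨h0, h1⟩, h2⟩
      refine ⟨(x μ + 1) / 2, ⟨by linarith, by linarith⟩, ?_⟩
      rw [hvw]
      ext ν
      by_cases h : ν = μ
      · subst h
        simp only [hv, he, PiLp.add_apply, PiLp.smul_apply, PiLp.single_apply, smul_eq_mul,
          if_true]
        ring
      · simp [hv, he, h, h2 ν h]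
  refine ⟨v, w, ?_, ?_, 1 / 2, by norm_num, ?_⟩
  · intro h
    have : v μ = w μ := by rw [h]
    simp [hv, hw] at this
    norm_num at this
  · rw [hseg]
    refine ⟨?_, ?_⟩
    · rintro x ⟨h1, h2⟩ ν
      by_cases h : ν = μ
      · subst h; exact h1
      · simp [h2 ν h]
    · rintro x hx y hy z ⟨_, hz⟩ hzo
      obtain ⟨a, b, ha, hb, hab, rfl⟩ := hzo
      refine ⟨hx μ, fun ν hν => ?_⟩
      have h1 := hz ν hν
      simp only [PiLp.add_apply, PiLp.smul_apply, smul_eq_mul] at h1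
      have h2 := (hx ν).2
      have h3 := (hy ν).2
      -- A proper convex combination of two numbers at most 1 equals 1 only if both do.
      nlinarith
  · rw [hvw, smul_smul]; norm_num

/-- Otherwise repeated differentiation makes η orthogonal to every AᵏBe; by normality these span, so
ζ would be orthogonal to itself. -/
theorem IsNormal.exists_switching_ne_zero {n m : ℕ} {A : Matrix (Fin n) (Fin n) ℝ}
    {B : Matrix (Fin n) (Fin m) ℝ} (hnormal : IsNormal A B (cube m)) {T : ℝ} {ζ : Vec n}
    (hζ : ζ ≠ 0) {η : ℝ → Vec n} (hη : IsAdjoint (-A) T ζ η) (μ : Fin m) :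
    ∃ t, rowMul (η t) (-B) μ ≠ 0 := by
  by_contra! hzero
  set e : Vec m := EuclideanSpace.single μ 1 with he
  have key : ∀ k : ℕ, ∀ t, inner ℝ (η t) (mulV (A ^ k * B) e) = 0 := by
    intro k
    induction k with
    | zero =>
      intro t
      have := hzero t
      rw [rowMul_apply, mulV_neg, inner_neg_right] at this
      simpa using this
    | succ k ih =>
      intro t
      have h1 := (hη.1 t).inner ℝ (hasDerivAt_const t (mulV (A ^ k * B) e))
      have h2 : (fun t => inner ℝ (η t) (mulV (A ^ k * B) e)) = fun _ => (0 : ℝ) := funext ih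
      rw [h2] at h1
      have h3 := h1.unique (hasDerivAt_const t (0 : ℝ))
      rw [inner_zero_right, zero_add, inner_neg_left, inner_rowMul, mulV_neg, inner_neg_right,
        neg_neg, ← mulV_mul, ← Matrix.mul_assoc, ← pow_succ'] at h3
      exact h3
  have hspan := hnormal e (isAlongEdge_cube_single μ)
  have htop : Submodule.span ℝ (range fun k : Fin n => mulV (A ^ (k : ℕ) * B) e) = ⊤ :=
    Submodule.eq_top_of_finrank_eq (by rw [hspan]; simp)
  have hmem : ζ ∈ Submodule.span ℝ (range fun k : Fin n => mulV (A ^ (k : ℕ) * B) e) := by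
    rw [htop]; trivial
  have : inner ℝ ζ ζ = (0 : ℝ) := by
    refine Submodule.span_induction (p := fun x _ => inner ℝ ζ x = (0 : ℝ)) ?_ ?_ ?_ ?_ hmem
    · rintro _ ⟨k, rfl⟩
      rw [← hη.2]; exact key k T
    · simp
    · intro x y _ _ hx hy; rw [inner_add_right, hx, hy, add_zero]
    · intro c x _ hx; rw [inner_smul_right, hx, mul_zero]
  exact hζ (inner_self_eq_zero.1 this)

/-- The nonzero set is codiscrete by the identity theorem, and codiscrete sets are conull. -/
theorem ae_ne_zero_of_analytic {f : ℝ → ℝ} (hf : ∀ t, AnalyticAt ℝ f t) (h : ∃ t, f t ≠ 0) :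
    ∀ᵐ t, f t ≠ 0 := by
  obtain ⟨t, ht⟩ := h
  have h1 : AnalyticOnNhd ℝ f univ := fun t _ => hf t
  have h2 := h1.preimage_zero_mem_codiscrete ht
  have h3 := ae_restrict_le_codiscreteWithin (μ := MeasureTheory.volume)
    (MeasurableSet.univ (α := ℝ)) h2
  rw [MeasureTheory.Measure.restrict_univ] at h3
  exact h3

theorem IsNormal.ae_switching_ne_zero {n m : ℕ} {A : Matrix (Fin n) (Fin n) ℝ}
    {B : Matrix (Fin n) (Fin m) ℝ} (hnormal : IsNormal A B (cube m)) {T : ℝ} {ζ : Vec n}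
    (hζ : ζ ≠ 0) {η : ℝ → Vec n} (hη : IsAdjoint (-A) T ζ η) :
    ∀ᵐ t, ∀ μ, rowMul (η t) (-B) μ ≠ 0 := by
  rw [MeasureTheory.ae_all_iff]
  intro μ
  refine ae_ne_zero_of_analytic (fun t => ?_) (hnormal.exists_switching_ne_zero hζ hη μ)
  set x := mulV (-B) (EuclideanSpace.single μ 1) with hx
  -- Transport to the end time exhibits the switching function through the exponential, which makes
  -- its analyticity visible.
  have h1 : (fun t => rowMul (η t) (-B) μ) = fun t => inner ℝ ζ (expL (-A) (T - t) x) := by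
    funext t
    rw [rowMul_apply, ← hη.inner_expL T t, hη.2]
  rw [h1]
  have h2 : AnalyticAt ℝ (fun t : ℝ => expL (-A) (T - t)) t :=
    (analyticAt_expL (-A) (T - t)).comp (f := fun t : ℝ => T - t)
      (analyticAt_const.sub analyticAt_id)
  exact (((innerSL ℝ ζ).comp (ContinuousLinearMap.apply ℝ (Vec n) x)).analyticAt _).comp h2

/-! ### Admissible controls -/

theorem norm_le_of_mem_cube {m : ℕ} {u : Vec m} (hu : u ∈ cube m) : ‖u‖ ≤ √m := by
  rw [EuclideanSpace.norm_eq]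
  refine Real.sqrt_le_sqrt ?_
  calc ∑ μ, ‖u μ‖ ^ 2 ≤ ∑ _μ : Fin m, (1 : ℝ) := by
        refine Finset.sum_le_sum fun μ _ => ?_
        rw [sq_le_one_iff₀ (norm_nonneg _), Real.norm_eq_abs, abs_le]
        exact hu μ
    _ = m := by simp

theorem IsAdmissible.intervalIntegrable {m : ℕ} {u : ℝ → Vec m} (hu : IsAdmissible (cube m) u)
    (a b : ℝ) : IntervalIntegrable u volume a b :=
  (intervalIntegrable_const (c := √m)).mono_fun' hu.1.aestronglyMeasurable
    (ae_of_all _ fun t => norm_le_of_mem_cube (hu.2 t))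

theorem IsAdmissible.intervalIntegrable_mulV {n m : ℕ} {u : ℝ → Vec m}
    (hu : IsAdmissible (cube m) u) (B : Matrix (Fin n) (Fin m) ℝ) (a b : ℝ) :
    IntervalIntegrable (fun r => mulV B (u r)) volume a b :=
  ⟨(mulVL B).integrable_comp (hu.intervalIntegrable a b).1,
    (mulVL B).integrable_comp (hu.intervalIntegrable a b).2⟩

theorem IsAdmissible.comp_sub_left {m : ℕ} {U : Set (Vec m)} {u : ℝ → Vec m}
    (hu : IsAdmissible U u) (T : ℝ) : IsAdmissible U fun s => u (T - s) :=
  ⟨hu.1.comp (measurable_const.sub measurable_id), fun _ => hu.2 _⟩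

theorem measurable_sign : Measurable Real.sign := by
  unfold Real.sign
  exact Measurable.ite measurableSet_Iio measurable_const
    (Measurable.ite measurableSet_Ioi measurable_const measurable_const)

theorem measurable_signVec {m : ℕ} : Measurable (signVec (m := m)) := by
  refine (WithLp.measurable_toLp 2 (Fin m → ℝ)).comp (measurable_pi_lambda _ fun μ => ?_)
  exact measurable_sign.comp
    ((measurable_pi_apply μ).comp (WithLp.measurable_ofLp 2 (Fin m → ℝ)))

theorem sign_mem_Icc (x : ℝ) : Real.sign x ∈ Icc (-1 : ℝ) 1 := by
  rcases Real.sign_apply_eq x with h | h | h <;> rw [h] <;> norm_num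

theorem signVec_mem_cube {m : ℕ} (v : Vec m) : signVec v ∈ cube m := fun μ => sign_mem_Icc (v μ)

theorem isAdmissible_signControl {n m : ℕ} (B : Matrix (Fin n) (Fin m) ℝ) {η : ℝ → Vec n}
    (hη : Continuous η) : IsAdmissible (cube m) (signControl B η) :=
  ⟨measurable_signVec.comp ((continuous_rowMul B).comp hη).measurable,
    fun _ => signVec_mem_cube _⟩

/-! ### Trajectories -/

theorem IsTrajectory.intervalIntegrable {n m : ℕ} {A : Matrix (Fin n) (Fin n) ℝ}
    {B : Matrix (Fin n) (Fin m) ℝ} {u : ℝ → Vec m} {y₀ : Vec n} {T : ℝ} {y : ℝ → Vec n}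
    (hu : IsAdmissible (cube m) u) (hy : IsTrajectory A B u y₀ T y) {a b : ℝ}
    (ha : a ∈ Icc 0 T) (hb : b ∈ Icc 0 T) :
    IntervalIntegrable (fun r => mulV A (y r) + mulV B (u r)) volume a b := by
  refine IntervalIntegrable.add (ContinuousOn.intervalIntegrable ?_) (hu.intervalIntegrable_mulV B a b)
  exact (continuous_mulV A).comp_continuousOn (hy.1.mono (uIcc_subset_Icc ha hb))

theorem IsTrajectory.apply_zero {n m : ℕ} {A : Matrix (Fin n) (Fin n) ℝ}
    {B : Matrix (Fin n) (Fin m) ℝ} {u : ℝ → Vec m} {y₀ : Vec n} {T : ℝ} {y : ℝ → Vec n}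
    (hT : 0 ≤ T) (hy : IsTrajectory A B u y₀ T y) : y 0 = y₀ := by
  simpa using hy.2 0 ⟨le_rfl, hT⟩

theorem IsTrajectory.reverse {n m : ℕ} {A : Matrix (Fin n) (Fin n) ℝ}
    {B : Matrix (Fin n) (Fin m) ℝ} {u : ℝ → Vec m} {y₀ : Vec n} {T : ℝ} {y : ℝ → Vec n}
    (hT : 0 ≤ T) (hu : IsAdmissible (cube m) u) (hy : IsTrajectory A B u y₀ T y) :
    IsTrajectory (-A) (-B) (fun s => u (T - s)) (y T) T (fun s => y (T - s)) := by
  have hmaps : MapsTo (fun s => T - s) (Icc 0 T) (Icc 0 T) := fun s hs =>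
    ⟨by linarith [hs.2], by linarith [hs.1]⟩
  have h0 : (0 : ℝ) ∈ Icc 0 T := ⟨le_rfl, hT⟩
  have h1 : T ∈ Icc 0 T := ⟨hT, le_rfl⟩
  refine ⟨hy.1.comp (continuousOn_const.sub continuousOn_id) hmaps, fun s hs => ?_⟩
  have hint : ∫ r in (0 : ℝ)..s, (mulV (-A) (y (T - r)) + mulV (-B) (u (T - r))) =
      -∫ r in (T - s)..T, (mulV A (y r) + mulV B (u r)) := by
    have := intervalIntegral.integral_comp_sub_left (a := 0) (b := s)
      (fun r => mulV A (y r) + mulV B (u r)) T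
    rw [sub_zero] at this
    rw [← this, ← intervalIntegral.integral_neg]
    simp only [mulV_neg, neg_add]
  rw [hint, ← intervalIntegral.integral_interval_sub_left
    (hy.intervalIntegrable hu h0 h1) (hy.intervalIntegrable hu h0 (hmaps hs)),
    hy.2 T h1]
  simp only [hy.2 (T - s) (hmaps hs)]
  abel

/-- Time reversal is an involution that exchanges the target 0 with the initial state. -/
theorem mem_reach_iff {n m : ℕ} {A : Matrix (Fin n) (Fin n) ℝ} {B : Matrix (Fin n) (Fin m) ℝ}
    {T : ℝ} (hT : 0 ≤ T) {x : Vec n} :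
    x ∈ reach A B (cube m) {0} T ↔ ∃ u, IsAdmissible (cube m) u ∧
      ∃ z, IsTrajectory (-A) (-B) u 0 T z ∧ z T = x := by
  constructor
  · rintro ⟨u, hu, y, hy, hyT⟩
    refine ⟨_, hu.comp_sub_left T, fun s => y (T - s), ?_, ?_⟩
    · have := hy.reverse hT hu
      rwa [mem_singleton_iff.1 hyT] at this
    · simp [hy.apply_zero hT]
  · rintro ⟨u, hu, z, hz, rfl⟩
    refine ⟨_, hu.comp_sub_left T, fun s => z (T - s), ?_, ?_⟩
    · simpa using hz.reverse hT hu
    · simp [hz.apply_zero hT]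

/-- Since `u` is only measurable, split off the primitive `G` of Bu: the remainder satisfies w' =
A(w + G), whose data are continuous, and variation of constants solves it classically. -/
theorem exists_isTrajectory {n m : ℕ} (A : Matrix (Fin n) (Fin n) ℝ)
    (B : Matrix (Fin n) (Fin m) ℝ) {u : ℝ → Vec m} (hu : IsAdmissible (cube m) u) (T : ℝ) :
    ∃ z, IsTrajectory A B u 0 T z := by
  set G : ℝ → Vec n := fun s => ∫ r in (0 : ℝ)..s, mulV B (u r) with hG
  have hGc : Continuous G :=
    intervalIntegral.continuous_primitive (fun a b => hu.intervalIntegrable_mulV B a b) 0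
  set H : ℝ → Vec n := fun s => ∫ r in (0 : ℝ)..s, expL A (-r) (mulV A (G r)) with hH
  have hic : Continuous fun r => expL A (-r) (mulV A (G r)) :=
    ((continuous_expL A).comp continuous_neg).clm_apply ((continuous_mulV A).comp hGc)
  have hHd : ∀ s, HasDerivAt H (expL A (-s) (mulV A (G s))) s := fun s =>
    hic.integral_hasStrictDerivAt 0 s |>.hasDerivAt
  set w : ℝ → Vec n := fun s => expL A s (H s) with hw
  have hwd : ∀ s, HasDerivAt w (mulV A (w s + G s)) s := by
    intro s
    have h1 := (hasDerivAt_expL A s).clm_apply (hHd s)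
    rw [expL_comp_neg] at h1
    have h2 : mulV A (w s + G s) = (Matrix.toEuclideanCLM (n := Fin n) (𝕜 := ℝ) A * expL A s) (H s) +
        mulV A (G s) := by
      rw [← mulVL_apply, map_add, mulVL_apply, mulVL_apply, mul_apply_eq_comp,
        toEuclideanCLM_eq_mulV]
    rw [h2]; exact h1
  have hwc : Continuous w := continuous_iff_continuousAt.2 fun s => (hwd s).continuousAt
  have hzc : Continuous fun s => w s + G s := hwc.add hGc
  have hAc : Continuous fun s => mulV A (w s + G s) := (continuous_mulV A).comp hzc
  refine ⟨fun s => w s + G s, hzc.continuousOn, fun s _ => ?_⟩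
  have h0 : w 0 = 0 := by simp [hw, hH]
  rw [intervalIntegral.integral_add (hAc.intervalIntegrable 0 s)
    (hu.intervalIntegrable_mulV B 0 s),
    intervalIntegral.integral_eq_sub_of_hasDerivAt (fun r _ => hwd r) (hAc.intervalIntegrable 0 s),
    h0, sub_zero, zero_add]

/-! ### Integration by parts and the maximum principle -/

theorem integral_add_mul_primitive {f g f' g' : ℝ → ℝ} {T : ℝ} (hT : 0 ≤ T)
    (hf' : IntervalIntegrable f' volume 0 T) (hg' : IntervalIntegrable g' volume 0 T)
    (hf : ∀ s ∈ Icc 0 T, f s = f 0 + ∫ r in (0 : ℝ)..s, f' r)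
    (hg : ∀ s ∈ Icc 0 T, g s = g 0 + ∫ r in (0 : ℝ)..s, g' r) :
    IntervalIntegrable (fun r => f' r * g r + f r * g' r) volume 0 T ∧
    ∫ r in (0 : ℝ)..T, (f' r * g r + f r * g' r) = f T * g T - f 0 * g 0 := by
  -- `f` and `g` are controlled only on [0,T], so they are replaced by primitives defined on the
  -- whole line, which agree with them there.
  have key : ∀ {φ φ' : ℝ → ℝ}, IntervalIntegrable φ' volume 0 T →
      AbsolutelyContinuousOnInterval (fun s => φ 0 + ∫ r in (0 : ℝ)..s, φ' r) 0 T ∧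
      ∀ᵐ r, r ∈ uIoc 0 T → deriv (fun s => φ 0 + ∫ r in (0 : ℝ)..s, φ' r) r = φ' r := by
    intro φ φ' h
    refine ⟨?_, ?_⟩
    · have h1 : AbsolutelyContinuousOnInterval (fun _ : ℝ => φ 0) 0 T :=
        (LipschitzWith.const (φ 0)).lipschitzOnWith.absolutelyContinuousOnInterval
      exact h1.add (h.absolutelyContinuousOnInterval_intervalIntegral (c := 0) (by simp))
    · filter_upwards [h.ae_hasDerivAt_integral] with r hr hrT
      exact ((hr (uIoc_subset_uIcc hrT) 0 (by simp)).const_add (φ 0)).deriv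
  obtain ⟨hF, hFd⟩ := key (φ := f) hf'
  obtain ⟨hG, hGd⟩ := key (φ := g) hg'
  have hmem : ∀ {r}, r ∈ uIoc 0 T → r ∈ Icc 0 T := fun h => by
    rw [uIoc_of_le hT] at h; exact Ioc_subset_Icc_self h
  have hint := hF.integral_deriv_mul_eq_sub hG
  have hfc : ContinuousOn f (uIcc 0 T) := hF.continuousOn.congr fun s hs =>
    hf s (by rwa [uIcc_of_le hT] at hs)
  have hgc : ContinuousOn g (uIcc 0 T) := hG.continuousOn.congr fun s hs =>
    hg s (by rwa [uIcc_of_le hT] at hs)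
  refine ⟨(hf'.mul_continuousOn hgc).add (hg'.continuousOn_mul hfc), ?_⟩
  rw [← hf T ⟨hT, le_rfl⟩, ← hg T ⟨hT, le_rfl⟩] at hint
  simp only [intervalIntegral.integral_same, add_zero] at hint
  rw [← hint]
  refine intervalIntegral.integral_congr_ae ?_
  filter_upwards [hFd, hGd] with r h1 h2 hr
  rw [h1 hr, h2 hr, ← hf r (hmem hr), ← hg r (hmem hr)]

theorem integral_add_inner_primitive {n : ℕ} {f g f' g' : ℝ → Vec n} {T : ℝ} (hT : 0 ≤ T)
    (hf' : IntervalIntegrable f' volume 0 T) (hg' : IntervalIntegrable g' volume 0 T)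
    (hf : ∀ s ∈ Icc 0 T, f s = f 0 + ∫ r in (0 : ℝ)..s, f' r)
    (hg : ∀ s ∈ Icc 0 T, g s = g 0 + ∫ r in (0 : ℝ)..s, g' r) :
    ∫ r in (0 : ℝ)..T, (inner ℝ (f' r) (g r) + inner ℝ (f r) (g' r)) =
      inner ℝ (f T) (g T) - inner ℝ (f 0) (g 0) := by
  have hcoord : ∀ {φ φ' : ℝ → Vec n}, IntervalIntegrable φ' volume 0 T →
      (∀ s ∈ Icc 0 T, φ s = φ 0 + ∫ r in (0 : ℝ)..s, φ' r) → ∀ μ,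
      IntervalIntegrable (fun r => φ' r μ) volume 0 T ∧
      ∀ s ∈ Icc 0 T, φ s μ = φ 0 μ + ∫ r in (0 : ℝ)..s, φ' r μ := by
    intro φ φ' h hφ μ
    refine ⟨⟨(EuclideanSpace.proj (𝕜 := ℝ) μ).integrable_comp h.1,
      (EuclideanSpace.proj (𝕜 := ℝ) μ).integrable_comp h.2⟩, fun s hs => ?_⟩
    have h1 := (EuclideanSpace.proj (𝕜 := ℝ) μ).intervalIntegral_comp_comm (h.mono_set
      (c := 0) (d := s) (by
        rw [uIcc_of_le hT, uIcc_of_le hs.1]; exact Icc_subset_Icc_right hs.2))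
    have h2 := congrArg (EuclideanSpace.proj (𝕜 := ℝ) μ) (hφ s hs)
    rw [map_add, ← h1] at h2
    exact h2
  have hmul := fun μ => integral_add_mul_primitive hT (hcoord hf' hf μ).1 (hcoord hg' hg μ).1
    (hcoord hf' hf μ).2 (hcoord hg' hg μ).2
  have hin : ∀ x y : Vec n, inner ℝ x y = ∑ μ, x μ * y μ := fun x y => by
    simp [PiLp.inner_apply, mul_comm]
  simp only [hin, ← Finset.sum_add_distrib, ← Finset.sum_sub_distrib]
  rw [intervalIntegral.integral_finsetSum fun μ _ => (hmul μ).1]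
  exact Finset.sum_congr rfl fun μ _ => (hmul μ).2

/-- In the derivative of ⟨η, z⟩ the terms with `A` cancel and only the control term survives. -/
theorem IsAdjoint.inner_trajectory {n m : ℕ} {A : Matrix (Fin n) (Fin n) ℝ}
    {B : Matrix (Fin n) (Fin m) ℝ} {T : ℝ} (hT : 0 ≤ T) {ζ : Vec n} {η : ℝ → Vec n}
    (hη : IsAdjoint A T ζ η) {u : ℝ → Vec m} (hu : IsAdmissible (cube m) u) {z : ℝ → Vec n}
    (hz : IsTrajectory A B u 0 T z) :
    inner ℝ ζ (z T) = ∫ r in (0 : ℝ)..T, inner ℝ (rowMul (η r) B) (u r) := by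
  have h0 := hz.apply_zero hT
  have hcont : Continuous fun r => -(rowMul (η r) A) :=
    ((continuous_rowMul A).comp hη.continuous).neg
  have h := integral_add_inner_primitive (f := η) (g := z) hT (hcont.intervalIntegrable 0 T)
    (hz.intervalIntegrable hu ⟨le_rfl, hT⟩ ⟨hT, le_rfl⟩) (fun s _ => by
      rw [intervalIntegral.integral_eq_sub_of_hasDerivAt (fun r _ => hη.1 r)
        (hcont.intervalIntegrable 0 s)]
      abel) (fun s hs => by rw [h0]; exact hz.2 s hs)
  rw [h0, inner_zero_right, sub_zero, hη.2] at h
  rw [← h]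
  congr 1
  funext r
  rw [inner_neg_left, inner_add_right, inner_rowMul, inner_rowMul]
  ring

theorem mul_sign_sub_nonneg {x v : ℝ} (hv : v ∈ Icc (-1 : ℝ) 1) : 0 ≤ x * (Real.sign x - v) := by
  rcases lt_trichotomy x 0 with h | h | h
  · rw [Real.sign_of_neg h]; nlinarith [hv.1]
  · simp [h]
  · rw [Real.sign_of_pos h]; nlinarith [hv.2]

theorem inner_signVec_sub_nonneg {m : ℕ} {x v : Vec m} (hv : v ∈ cube m) :
    0 ≤ inner ℝ x (signVec x - v) := by
  rw [PiLp.inner_apply]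
  refine Finset.sum_nonneg fun μ _ => ?_
  have := mul_sign_sub_nonneg (x := x μ) (hv μ)
  simpa [signVec, mul_comm] using this

/-- The inner product is a sum of nonnegative terms, so each of them vanishes. -/
theorem eq_signVec_of_inner_eq_zero {m : ℕ} {x v : Vec m} (hv : v ∈ cube m)
    (hx : ∀ μ, x μ ≠ 0) (h : inner ℝ x (signVec x - v) = (0 : ℝ)) : v = signVec x := by
  have h1 : ∑ μ, x μ * (Real.sign (x μ) - v μ) = 0 := by
    rw [← h, PiLp.inner_apply]
    simp [signVec, mul_comm]
  have h2 := (Finset.sum_eq_zero_iff_of_nonneg fun μ _ => mul_sign_sub_nonneg (hv μ)).1 h1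
  ext μ
  have h3 := (mul_eq_zero.1 (h2 μ (Finset.mem_univ μ))).resolve_left (hx μ)
  simp only [signVec]
  linarith

/-- The maximum principle: the extremal control is the unique one steering to a boundary point. -/
theorem exists_trajectory_signControl {n m : ℕ} {A : Matrix (Fin n) (Fin n) ℝ}
    {B : Matrix (Fin n) (Fin m) ℝ} (hnormal : IsNormal A B (cube m)) {T : ℝ} (hT : 0 ≤ T)
    {yhat ζ : Vec n} (hζ : ζ ∈ normalCone (reach A B (cube m) {0} T) yhat) (hζ0 : ζ ≠ 0)
    {η : ℝ → Vec n} (hη : IsAdjoint (-A) T ζ η) :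
    ∃ y, IsTrajectory (-A) (-B) (signControl (-B) η) 0 T y ∧ y T = yhat := by
  obtain ⟨u, hu, z, hz, hzT⟩ := (mem_reach_iff hT).1 hζ.1
  set v := signControl (-B) η with hv
  have hva : IsAdmissible (cube m) v := isAdmissible_signControl (-B) hη.continuous
  obtain ⟨x, hx⟩ := exists_isTrajectory (-A) (-B) hva T
  have hle := hζ.2 (x T) ((mem_reach_iff hT).2 ⟨v, hva, x, hx, rfl⟩)
  have hσ : Continuous fun r => rowMul (η r) (-B) := (continuous_rowMul (-B)).comp hη.continuous
  have hint : ∀ {w : ℝ → Vec m}, IsAdmissible (cube m) w →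
      IntervalIntegrable (fun r => inner ℝ (rowMul (η r) (-B)) (w r)) volume 0 T := by
    intro w hw
    have hin : ∀ x y : Vec m, inner ℝ x y = ∑ μ, x μ * y μ := fun x y => by
      simp [PiLp.inner_apply, mul_comm]
    simp only [hin]
    have hsum := IntervalIntegrable.sum (μ := volume) (a := 0) (b := T) Finset.univ
      (f := fun μ r => rowMul (η r) (-B) μ * w r μ) fun μ _ => by
        refine IntervalIntegrable.continuousOn_mul (f := fun r => w r μ) ?_ ?_
        · have h := hw.intervalIntegrable 0 T
          exact ⟨(EuclideanSpace.proj (𝕜 := ℝ) μ).integrable_comp h.1,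
            (EuclideanSpace.proj (𝕜 := ℝ) μ).integrable_comp h.2⟩
        · exact ((EuclideanSpace.proj (𝕜 := ℝ) μ).continuous.comp hσ).continuousOn
    rw [Finset.sum_fn] at hsum
    exact hsum
  have hdiff : ∫ r in (0 : ℝ)..T, inner ℝ (rowMul (η r) (-B)) (v r - u r) ≤ 0 := by
    simp only [inner_sub_right]
    rw [intervalIntegral.integral_sub (hint hva) (hint hu),
      ← hη.inner_trajectory hT hva hx, ← hη.inner_trajectory hT hu hz, ← inner_sub_right, hzT]
    exact hle
  have hnn : ∀ r, 0 ≤ inner ℝ (rowMul (η r) (-B)) (v r - u r) := fun r =>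
    inner_signVec_sub_nonneg (hu.2 r)
  have hzero : ∫ r in (0 : ℝ)..T, inner ℝ (rowMul (η r) (-B)) (v r - u r) = 0 :=
    le_antisymm hdiff (intervalIntegral.integral_nonneg hT fun r _ => hnn r)
  rw [intervalIntegral.integral_eq_zero_iff_of_le_of_nonneg_ae hT (ae_of_all _ hnn) (by
    simp only [inner_sub_right]; exact (hint hva).sub (hint hu))] at hzero
  have hae : ∀ᵐ r, r ∈ Ioc 0 T → u r = v r := by
    filter_upwards [(ae_restrict_iff' measurableSet_Ioc).1 hzero,
      hnormal.ae_switching_ne_zero hζ0 hη] with r h1 h2 hr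
    exact eq_signVec_of_inner_eq_zero (hu.2 r) h2 (h1 hr)
  -- Changing the control on a null set leaves the integral equation intact, so `z` is also driven
  -- by the sign control.
  refine ⟨z, ⟨hz.1, fun s hs => ?_⟩, hzT⟩
  rw [hz.2 s hs]
  congr 1
  refine intervalIntegral.integral_congr_ae ?_
  filter_upwards [hae] with r h hr
  rw [uIoc_of_le hs.1] at hr
  rw [h ⟨hr.1, hr.2.trans hs.2⟩]

/-- From an interior point a small step along ζ stays in `R` but increases ⟨ζ, ·⟩. -/
theorem not_mem_interior_of_normalCone {n : ℕ} {R : Set (Vec n)} {x ζ : Vec n}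
    (hζ : ζ ∈ normalCone R x) (hζ0 : ζ ≠ 0) : x ∉ interior R := by
  intro hx
  have hc : Tendsto (fun s : ℝ => x + s • ζ) (𝓝[>] 0) (𝓝 x) := by
    have : Continuous fun s : ℝ => x + s • ζ := by fun_prop
    have h := this.tendsto 0
    simp only [zero_smul, add_zero] at h
    exact h.mono_left nhdsWithin_le_nhds
  obtain ⟨s, hs, hs0⟩ := ((hc.eventually (mem_interior_iff_mem_nhds.1 hx)).and
    self_mem_nhdsWithin).exists
  have h := hζ.2 _ hs
  rw [add_sub_cancel_left, inner_smul_right, real_inner_self_eq_norm_sq] at h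
  have : 0 < s * ‖ζ‖ ^ 2 := mul_pos hs0 (by positivity)
  linarith

theorem minTime_eq {n m : ℕ} {A : Matrix (Fin n) (Fin n) ℝ} {B : Matrix (Fin n) (Fin m) ℝ}
    {tf T : ℝ} (hT : 0 ≤ T) (hTf : T ≤ tf) (hexp : StrictlyExpanding A B (cube m) {0} tf)
    {yhat ζ : Vec n} (hζ : ζ ∈ normalCone (reach A B (cube m) {0} T) yhat) (hζ0 : ζ ≠ 0) :
    minTime A B (cube m) {0} yhat = ENNReal.ofReal T := by
  refine le_antisymm (sInf_le ⟨T, hT, hζ.1, rfl⟩) (le_sInf ?_)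
  rintro _ ⟨t, ht, hmem, rfl⟩
  refine ENNReal.ofReal_le_ofReal (not_lt.1 fun hlt => ?_)
  exact not_mem_interior_of_normalCone hζ hζ0 (hexp t T ht hlt hTf hmem)

/-! ### Convergence of normal cones -/

/-- The projection of `yhat + ζ` onto a convex set close to `R` is close to `yhat`. -/
theorem norm_sub_le_of_normalCone {n : ℕ} {R C : Set (Vec n)} {yhat ζ y : Vec n} {ε : ℝ}
    (hζ : ζ ∈ normalCone R yhat) (hy : y ∈ C)
    (hmin : ∀ y' ∈ C, ‖yhat + ζ - y‖ ≤ ‖yhat + ζ - y'‖)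
    (hdist : Metric.hausdorffEDist C R < ENNReal.ofReal ε) :
    ‖y - yhat‖ ≤ ε + √(4 * ε * ‖ζ‖ + 4 * ε ^ 2) := by
  obtain ⟨c, hcR, hc⟩ := Metric.exists_edist_lt_of_hausdorffEDist_lt hy hdist
  obtain ⟨y', hy'C, hy'⟩ := Metric.exists_edist_lt_of_hausdorffEDist_lt hζ.1
    (by rwa [Metric.hausdorffEDist_comm] at hdist)
  rw [edist_lt_ofReal, dist_eq_norm] at hc hy'
  have h1 : ‖yhat + ζ - y'‖ ≤ ‖ζ‖ + ε := by
    calc ‖yhat + ζ - y'‖ = ‖ζ + (yhat - y')‖ := by congr 1; abel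
      _ ≤ ‖ζ‖ + ‖yhat - y'‖ := norm_add_le _ _
      _ ≤ _ := by gcongr
  have h2 : ‖ζ - (c - yhat)‖ ≤ ‖ζ‖ + 2 * ε := by
    calc ‖ζ - (c - yhat)‖ = ‖(yhat + ζ - y) + (y - c)‖ := by congr 1; abel
      _ ≤ ‖yhat + ζ - y‖ + ‖y - c‖ := norm_add_le _ _
      _ ≤ (‖ζ‖ + ε) + ε := by gcongr; exact (hmin y' hy'C).trans h1
      _ = _ := by ring
  have h3 : ‖ζ - (c - yhat)‖ ^ 2 = ‖ζ‖ ^ 2 - 2 * inner ℝ ζ (c - yhat) + ‖c - yhat‖ ^ 2 :=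
    norm_sub_sq_real _ _
  have h4 := hζ.2 c hcR
  have h5 : ‖ζ - (c - yhat)‖ ^ 2 ≤ (‖ζ‖ + 2 * ε) ^ 2 := by gcongr
  have h6 : ‖c - yhat‖ ≤ √(4 * ε * ‖ζ‖ + 4 * ε ^ 2) := by
    refine Real.le_sqrt_of_sq_le ?_
    -- Expand `h5` with `h3` and drop the inner product, which is nonpositive by `h4`; the excess
    -- (‖ζ‖ + 2ε)² − ‖ζ‖² is the radicand.
    nlinarith
  calc ‖y - yhat‖ = ‖(y - c) + (c - yhat)‖ := by congr 1; abel
    _ ≤ ‖y - c‖ + ‖c - yhat‖ := norm_add_le _ _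
    _ ≤ _ := by gcongr

theorem exists_tendsto_normalCone {n : ℕ} {R : Set (Vec n)} {C : ℕ → Set (Vec n)}
    (hcomp : ∀ ν, IsCompact (C ν)) (hconvex : ∀ ν, Convex ℝ (C ν))
    (hconv : Tendsto (fun ν => Metric.hausdorffEDist (C ν) R) atTop (𝓝 0))
    {yhat ζ : Vec n} (hζ : ζ ∈ normalCone R yhat) :
    ∃ yh ζh : ℕ → Vec n, (∀ᶠ ν in atTop, ζh ν ∈ normalCone (C ν) (yh ν)) ∧
      Tendsto (fun ν => (yh ν, ζh ν)) atTop (𝓝 (yhat, ζ)) := by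
  have hproj : ∀ ν, ∃ y, (C ν).Nonempty → y ∈ C ν ∧
      (∀ y' ∈ C ν, ‖yhat + ζ - y‖ ≤ ‖yhat + ζ - y'‖) ∧
      ∀ y' ∈ C ν, inner ℝ (yhat + ζ - y) (y' - y) ≤ 0 := by
    intro ν
    by_cases hne : (C ν).Nonempty
    · obtain ⟨y, hy, hmin⟩ := exists_norm_eq_iInf_of_complete_convex hne
        (hcomp ν).isComplete (hconvex ν) (yhat + ζ)
      refine ⟨y, fun _ => ⟨hy, fun y' hy' => ?_,
        (norm_eq_iInf_iff_real_inner_le_zero (hconvex ν) hy).1 hmin⟩⟩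
      rw [hmin]
      exact ciInf_le ⟨0, by rintro _ ⟨w, rfl⟩; exact norm_nonneg _⟩ (⟨y', hy'⟩ : C ν)
    · exact ⟨0, fun h => absurd h hne⟩
  choose yh hyh using hproj
  have hevent : ∀ ε > 0, ∀ᶠ ν in atTop, Metric.hausdorffEDist (C ν) R < ENNReal.ofReal ε :=
    fun ε hε => hconv.eventually_lt_const (ENNReal.ofReal_pos.2 hε)
  have hne : ∀ {ν : ℕ} {ε : ℝ}, Metric.hausdorffEDist (C ν) R < ENNReal.ofReal ε →
      (C ν).Nonempty := fun h => Metric.nonempty_of_hausdorffEDist_ne_top ⟨yhat, hζ.1⟩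
        (by rw [Metric.hausdorffEDist_comm]; exact (h.trans ENNReal.ofReal_lt_top).ne)
  have hy : Tendsto yh atTop (𝓝 yhat) := by
    have hb : Tendsto (fun ε : ℝ => ε + √(4 * ε * ‖ζ‖ + 4 * ε ^ 2)) (𝓝[>] 0) (𝓝 0) := by
      have hc : Continuous fun ε : ℝ => ε + √(4 * ε * ‖ζ‖ + 4 * ε ^ 2) := by fun_prop
      have h := hc.tendsto 0
      norm_num at h
      exact h.mono_left nhdsWithin_le_nhds
    rw [Metric.tendsto_nhds]
    intro δ hδ
    obtain ⟨ε, hεδ, hε⟩ := ((hb.eventually_lt_const hδ).and self_mem_nhdsWithin).exists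
    filter_upwards [hevent ε hε] with ν hν
    obtain ⟨h1, h2, _⟩ := hyh ν (hne hν)
    rw [dist_eq_norm]
    exact (norm_sub_le_of_normalCone hζ h1 h2 hν).trans_lt hεδ
  refine ⟨yh, fun ν => yhat + ζ - yh ν, ?_, ?_⟩
  · filter_upwards [hevent 1 one_pos] with ν hν
    obtain ⟨h1, _, h3⟩ := hyh ν (hne hν)
    exact ⟨h1, h3⟩
  · refine hy.prodMk_nhds ?_
    have := (tendsto_const_nhds (x := yhat + ζ)).sub hy
    rwa [add_sub_cancel_left] at this

/-! ### The discrete adjoint equation -/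

namespace Discretization

variable {n m : ℕ}

theorem h_pos (D : Discretization n m) {Δt : ℝ} (hΔt : 0 < Δt) : 0 < D.h Δt :=
  div_pos hΔt (by exact_mod_cast D.N_pos)

theorem N_mul_h (D : Discretization n m) (Δt : ℝ) : D.N * D.h Δt = Δt := by
  have : (D.N : ℝ) ≠ 0 := by exact_mod_cast D.N_pos.ne'
  rw [h]; field_simp

theorem grid_eq (D : Discretization n m) (Δt : ℝ) (k j : ℕ) :
    D.grid Δt k j = ((k * D.N + j : ℕ) : ℝ) * D.h Δt := by
  have := D.N_mul_h Δt
  rw [grid]; push_cast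
  linear_combination -(k : ℝ) * this

theorem isCompact_reachSet {D : Discretization n m} {Bbar : Matrix (Fin n) (Fin m) ℝ}
    {U : Set (Vec m)} {S : Set (Vec n)} {Δt : ℝ} {K : ℕ} (hrun : D.IsRun Bbar U S Δt K) {k : ℕ}
    (hk : k < K) : IsCompact (D.reachSet (k + 1)) := by
  obtain ⟨f, _, hf⟩ := hrun.next k hk
  refine Set.Finite.isCompact_convexHull (𝕜 := ℝ) ?_
  rw [hf]
  exact D.dirR.finite_toSet.image f

theorem IsAdjoint.eq_rowMul {D : Discretization n m} {i : ℕ} {ζ : Vec n} {η : ℕ → ℕ → Vec n}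
    (hη : D.IsAdjoint i ζ η) {k : ℕ} (hk : k < i) {j : ℕ} (hj : j ≤ D.N) :
    η k j = rowMul (η k D.N) (transition D.step ((k + 1) * D.N) (k * D.N + j)) := by
  have hN : (k + 1) * D.N = k * D.N + D.N := by ring
  rw [hN]
  have hself : ∀ a, transition D.step a a = 1 := by
    intro a; cases a <;> simp [transition]
  induction hj using Nat.decreasingInduction with
  | self => rw [hself, rowMul_one]
  | of_succ j hj ih =>
    rw [hη.back k hk j hj, ih, ← rowMul_mul, transition_mul _ (by omega) (by omega)]

/-- One macro step backwards: the error of the discrete adjoint at all points of the interval is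
controlled by the one at its right end. -/
theorem norm_adjoint_sub_le {D : Discretization n m} {Abar : Matrix (Fin n) (Fin n) ℝ} {Δt T ε : ℝ}
    {K i : ℕ} (hsolver : D.SolverError Abar Δt K ε) (hiK : i ≤ K) {ζ ζh : Vec n} {η : ℝ → Vec n}
    (hη : MinTime.IsAdjoint Abar T ζ η) {ηh : ℕ → ℕ → Vec n} (hηh : D.IsAdjoint i ζh ηh) {M : ℝ}
    (hΔt : 0 < Δt) (hM : ∀ s ∈ Icc 0 Δt, ‖expL Abar s‖ ≤ M) {k : ℕ} (hk : k < i) {j : ℕ}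
    (hj : j ≤ D.N) :
    ‖ηh k j - η (D.grid Δt k j)‖ ≤ ε * ‖ηh k D.N‖ + M * ‖ηh k D.N - η ((k + 1 : ℕ) * Δt)‖ := by
  set s := D.grid Δt (k + 1) 0 - D.grid Δt k j with hs
  set Φ := transition D.step ((k + 1) * D.N) (k * D.N + j) with hΦ
  have hend : D.grid Δt (k + 1) 0 = (k + 1 : ℕ) * Δt := by simp [grid]
  have hsmem : s ∈ Icc 0 Δt := by
    have h1 : s = Δt - j * D.h Δt := by
      rw [hs, hend, grid]; push_cast; ring
    have h2 := D.N_mul_h Δt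
    have h3 : (j : ℝ) * D.h Δt ≤ D.N * D.h Δt := by
      have := (D.h_pos hΔt).le
      gcongr
    have h4 : 0 ≤ (j : ℝ) * D.h Δt := mul_nonneg (Nat.cast_nonneg _) (D.h_pos hΔt).le
    rw [h1]; constructor <;> linarith
  have hexact : η (D.grid Δt k j) =
      rowMul (η ((k + 1 : ℕ) * Δt)) (NormedSpace.exp (s • Abar)) := by
    rw [hs, hend, hη.rowMul_exp]
  -- The error consists of the solver defect acting on the discrete end value and the exact flow
  -- acting on the end error.
  have hsplit : ηh k j - η (D.grid Δt k j) =
      -rowMul (ηh k D.N) (NormedSpace.exp (s • Abar) - Φ) +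
        rowMul (ηh k D.N - η ((k + 1 : ℕ) * Δt)) (NormedSpace.exp (s • Abar)) := by
    rw [hηh.eq_rowMul hk hj, hexact, rowMul_sub, sub_rowMul]
    abel
  rw [hsplit]
  refine (norm_add_le _ _).trans (add_le_add ?_ ?_)
  · rw [norm_neg]
    refine (norm_rowMul_le _ _).trans ?_
    gcongr
    exact hsolver k (hk.trans_le hiK) j hj
  · refine (norm_rowMul_le _ _).trans ?_
    gcongr
    rw [specNorm_exp]
    exact hM s hsmem

/-- Uniform convergence of the discrete adjoints on the grid. -/
theorem exists_adjoint_error {D : ℕ → Discretization n m} {Abar : Matrix (Fin n) (Fin n) ℝ}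
    {Δt : ℝ} (hΔt : 0 < Δt) {K i : ℕ} (hi : 1 ≤ i) (hiK : i ≤ K) {ε : ℕ → ℝ}
    (hε : Tendsto ε atTop (𝓝 0)) (hsolver : ∀ ν, (D ν).SolverError Abar Δt K (ε ν))
    {ζ : Vec n} {η : ℝ → Vec n} (hη : MinTime.IsAdjoint Abar (i * Δt) ζ η) {ζh : ℕ → Vec n}
    (hζh : Tendsto ζh atTop (𝓝 ζ)) {ηh : ℕ → ℕ → ℕ → Vec n}
    (hηh : ∀ ν, (D ν).IsAdjoint i (ζh ν) (ηh ν)) :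
    ∃ e : ℕ → ℝ, Tendsto e atTop (𝓝 0) ∧ ∀ ν, ∀ k < i, ∀ j ≤ (D ν).N,
      ‖ηh ν k j - η ((D ν).grid Δt k j)‖ ≤ e ν := by
  obtain ⟨M, hM⟩ := isCompact_Icc.exists_bound_of_continuousOn
    ((continuous_expL Abar).continuousOn (s := Icc 0 Δt))
  have hM0 : 0 ≤ M := (norm_nonneg _).trans (hM 0 ⟨le_rfl, hΔt.le⟩)
  have hε0 : ∀ ν, 0 ≤ ε ν := fun ν =>
    (norm_nonneg _).trans (hsolver ν 0 (by omega) 0 (Nat.zero_le _))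
  -- An error tending to zero at the right end of a macro interval yields one on its whole grid.
  have hstep : ∀ k < i, (∃ e : ℕ → ℝ, Tendsto e atTop (𝓝 0) ∧
      ∀ ν, ‖ηh ν k (D ν).N - η ((k + 1 : ℕ) * Δt)‖ ≤ e ν) →
      ∃ e : ℕ → ℝ, Tendsto e atTop (𝓝 0) ∧ ∀ ν, ∀ j ≤ (D ν).N,
        ‖ηh ν k j - η ((D ν).grid Δt k j)‖ ≤ e ν := by
    rintro k hk ⟨e, he, hb⟩
    refine ⟨fun ν => ε ν * (‖η ((k + 1 : ℕ) * Δt)‖ + e ν) + M * e ν, ?_, fun ν j hj => ?_⟩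
    · have := (hε.mul (he.const_add ‖η ((k + 1 : ℕ) * Δt)‖)).add (he.const_mul M)
      simpa using this
    · refine (norm_adjoint_sub_le (hsolver ν) hiK hη (hηh ν) hΔt hM hk hj).trans ?_
      have h1 : ‖ηh ν k (D ν).N‖ ≤ ‖η ((k + 1 : ℕ) * Δt)‖ + e ν := by
        have := norm_le_norm_add_norm_sub' (ηh ν k (D ν).N) (η ((k + 1 : ℕ) * Δt))
        exact this.trans (by gcongr; exact hb ν)
      exact add_le_add (mul_le_mul_of_nonneg_left h1 (hε0 ν))
        (mul_le_mul_of_nonneg_left (hb ν) hM0)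
  -- Here `l` counts macro intervals backwards from the last one.
  have hall : ∀ l, l < i → ∃ e : ℕ → ℝ, Tendsto e atTop (𝓝 0) ∧ ∀ ν, ∀ j ≤ (D ν).N,
      ‖ηh ν (i - 1 - l) j - η ((D ν).grid Δt (i - 1 - l) j)‖ ≤ e ν := by
    intro l
    induction l with
    | zero =>
      intro _
      refine hstep _ (by omega) ⟨fun ν => ‖ζh ν - ζ‖, ?_, fun ν => ?_⟩
      · have := (hζh.sub_const ζ).norm
        simpa using this
      · rw [Nat.sub_zero, Nat.sub_add_cancel hi, (hηh ν).final, hη.2]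
    | succ l ih =>
      intro hl
      obtain ⟨e, he, hb⟩ := ih (by omega)
      refine hstep _ (by omega) ⟨e, he, fun ν => ?_⟩
      have h1 : i - 1 - (l + 1) + 1 = i - 1 - l := by omega
      rw [(hηh ν).glue _ (by omega), h1]
      have := hb ν 0 (Nat.zero_le _)
      simpa [grid] using this
  have hall' : ∀ k, ∃ e : ℕ → ℝ, Tendsto e atTop (𝓝 0) ∧ (k < i → ∀ ν, ∀ j ≤ (D ν).N,
      ‖ηh ν k j - η ((D ν).grid Δt k j)‖ ≤ e ν) := by
    intro k
    by_cases hk : k < i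
    · obtain ⟨e, he, hb⟩ := hall (i - 1 - k) (by omega)
      rw [show i - 1 - (i - 1 - k) = k by omega] at hb
      exact ⟨e, he, fun _ => hb⟩
    · exact ⟨0, tendsto_const_nhds, fun h => absurd h hk⟩
  choose e he hb using hall'
  -- The sum of the nonnegative bounds dominates each of them, and it has a fixed number of terms.
  refine ⟨fun ν => ∑ k ∈ Finset.range i, e k ν, ?_, fun ν k hk j hj => ?_⟩
  · simpa using tendsto_finsetSum (Finset.range i) fun k _ => he k
  · refine (hb k hk ν j hj).trans (Finset.single_le_sum (f := fun k => e k ν)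
      (fun k' hk' => ?_) (Finset.mem_range.2 hk))
    exact (norm_nonneg _).trans (hb k' (Finset.mem_range.1 hk') ν 0 (Nat.zero_le _))

/-! ### The discrete controls -/

/-- The index of the grid point to the left of `t`. -/
noncomputable def index (D : Discretization n m) (Δt t : ℝ) : ℕ := ⌊t / D.h Δt⌋₊

/-- Division with remainder by `N` splits the global index into macro interval and step. -/
theorem index_spec (D : Discretization n m) {Δt : ℝ} (hΔt : 0 < Δt) {i : ℕ} {t : ℝ}
    (ht : t ∈ Ico 0 (i * Δt)) :
    D.index Δt t / D.N < i ∧ D.index Δt t % D.N < D.N ∧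
      t ∈ Ico (D.grid Δt (D.index Δt t / D.N) (D.index Δt t % D.N))
        (D.grid Δt (D.index Δt t / D.N) (D.index Δt t % D.N + 1)) := by
  have hh := D.h_pos hΔt
  set q := D.index Δt t with hq
  have hdm : q / D.N * D.N + q % D.N = q := Nat.div_add_mod' q D.N
  have hlow : (q : ℝ) * D.h Δt ≤ t := by
    rw [← le_div_iff₀ hh]; exact Nat.floor_le (div_nonneg ht.1 hh.le)
  have hup : t < ((q + 1 : ℕ) : ℝ) * D.h Δt := by
    rw [← div_lt_iff₀ hh]; push_cast; exact Nat.lt_floor_add_one _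
  refine ⟨?_, Nat.mod_lt _ D.N_pos, ?_⟩
  · rw [Nat.div_lt_iff_lt_mul D.N_pos]
    have h1 : (q : ℝ) * D.h Δt < ((i * D.N : ℕ) : ℝ) * D.h Δt := by
      push_cast
      rw [mul_assoc, D.N_mul_h]
      exact hlow.trans_lt ht.2
    exact_mod_cast lt_of_mul_lt_mul_right h1 hh.le
  · rw [grid_eq, grid_eq, ← add_assoc, hdm]
    exact ⟨hlow, hup⟩

theorem IsSignControl.eq_on_Ico {D : Discretization n m} {Bbar : Matrix (Fin n) (Fin m) ℝ}
    {Δt : ℝ} (hΔt : 0 < Δt) {i : ℕ} {η : ℕ → ℕ → Vec n} {u : ℝ → Vec m}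
    (hu : D.IsSignControl Bbar Δt i η u) {t : ℝ} (ht : t ∈ Ico 0 (i * Δt)) :
    u t = signVec (rowMul (η (D.index Δt t / D.N) (D.index Δt t % D.N)) Bbar) := by
  obtain ⟨h1, h2, h3⟩ := D.index_spec hΔt ht
  exact hu.piece _ h1 _ h2 t h3

theorem IsSignControl.aestronglyMeasurable {D : Discretization n m}
    {Bbar : Matrix (Fin n) (Fin m) ℝ} {Δt : ℝ} (hΔt : 0 < Δt) {i : ℕ} {η : ℕ → ℕ → Vec n}
    {u : ℝ → Vec m} (hu : D.IsSignControl Bbar Δt i η u) :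
    AEStronglyMeasurable u (volume.restrict (Ioc 0 (i * Δt))) := by
  have hmeas : Measurable fun t : ℝ =>
      signVec (rowMul (η (D.index Δt t / D.N) (D.index Δt t % D.N)) Bbar) :=
    (measurable_from_nat (f := fun q : ℕ => signVec (rowMul (η (q / D.N) (q % D.N)) Bbar))).comp
      (Nat.measurable_floor.comp (measurable_id.div_const _))
  refine ⟨_, hmeas.stronglyMeasurable, ?_⟩
  -- The formula for the pieces covers half-open intervals, so the end point is discarded as a null
  -- set.
  rw [← restrict_Ico_eq_restrict_Ioc]
  filter_upwards [ae_restrict_mem measurableSet_Ico] with t ht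
  exact hu.eq_on_Ico hΔt ht

theorem tendsto_grid_index {D : ℕ → Discretization n m}
    (hN : Tendsto (fun ν => (D ν).N) atTop atTop) {Δt : ℝ} (hΔt : 0 < Δt) {i : ℕ} {t : ℝ}
    (ht : t ∈ Ico 0 (i * Δt)) :
    Tendsto (fun ν => (D ν).grid Δt ((D ν).index Δt t / (D ν).N) ((D ν).index Δt t % (D ν).N))
      atTop (𝓝 t) := by
  have hh : Tendsto (fun ν => (D ν).h Δt) atTop (𝓝 0) :=
    (tendsto_const_div_atTop_nhds_zero_nat Δt).comp hN
  have hlow : Tendsto (fun ν => t - (D ν).h Δt) atTop (𝓝 t) := by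
    simpa using tendsto_const_nhds.sub hh
  refine tendsto_of_tendsto_of_tendsto_of_le_of_le hlow tendsto_const_nhds (fun ν => ?_)
    fun ν => ((D ν).index_spec hΔt ht).2.2.1
  have h := ((D ν).index_spec hΔt ht).2.2.2
  simp only [grid_eq] at h ⊢
  push_cast at h ⊢
  linarith

end Discretization

/-! ### Convergence of the controls -/

theorem norm1_nonneg {m : ℕ} (v : Vec m) : 0 ≤ norm1 v :=
  Finset.sum_nonneg fun _ _ => abs_nonneg _

theorem continuous_norm1 {m : ℕ} : Continuous (norm1 (m := m)) :=
  continuous_finsetSum _ fun μ _ => (EuclideanSpace.proj (𝕜 := ℝ) μ).continuous.abs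

theorem norm1_sub_le_of_mem_cube {m : ℕ} {v w : Vec m} (hv : v ∈ cube m) (hw : w ∈ cube m) :
    norm1 (v - w) ≤ 2 * m := by
  calc norm1 (v - w) ≤ ∑ _μ : Fin m, (2 : ℝ) := by
        refine Finset.sum_le_sum fun μ _ => ?_
        have h1 := hv μ
        have h2 := hw μ
        rw [PiLp.sub_apply, abs_le]
        constructor <;> linarith [h1.1, h1.2, h2.1, h2.2]
    _ = 2 * m := by simp [mul_comm]

theorem eventually_sign_eq {x : ℝ} (hx : x ≠ 0) : ∀ᶠ y in 𝓝 x, Real.sign y = Real.sign x := by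
  rcases lt_or_gt_of_ne hx with h | h
  · filter_upwards [eventually_lt_nhds h] with y hy
    rw [Real.sign_of_neg h, Real.sign_of_neg hy]
  · filter_upwards [eventually_gt_nhds h] with y hy
    rw [Real.sign_of_pos h, Real.sign_of_pos hy]

theorem eventually_signVec_eq {m : ℕ} {x : Vec m} (hx : ∀ μ, x μ ≠ 0) :
    ∀ᶠ y in 𝓝 x, signVec y = signVec x := by
  have h : ∀ᶠ y in 𝓝 x, ∀ μ, Real.sign (y μ) = Real.sign (x μ) := eventually_all.2 fun μ =>
    (EuclideanSpace.proj (𝕜 := ℝ) μ).continuous.continuousAt.eventually (eventually_sign_eq (hx μ))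
  filter_upwards [h] with y hy
  ext μ
  exact hy μ

end MinTime

/-! ### Assembly of the three conclusions. -/

theorem mainTheorem4 {n m : ℕ}
    (A : Matrix (Fin n) (Fin n) ℝ) (B : Matrix (Fin n) (Fin m) ℝ)
    (tf : ℝ) (htf : 0 < tf) (K : ℕ) (hK : 0 < K) (Δt : ℝ) (hΔt : Δt = tf / K)
    (hexp : StrictlyExpanding A B (cube m) {0} tf)
    (hnormal : IsNormal A B (cube m))
    (i : ℕ) (hi : 1 ≤ i) (hiK : i ≤ K)
    (D : ℕ → Discretization n m)
    (hN : Tendsto (fun ν => (D ν).N) atTop atTop)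
    (hrun : ∀ ν, (D ν).IsRun (-B) (cube m) {0} Δt K)
    (p C : ℝ) (hp : 0 < p)
    (hsolver : ∀ ν, (D ν).SolverError (-A) Δt K (C * (D ν).h Δt ^ p))
    (hconv : Tendsto (fun ν => Metric.hausdorffEDist ((D ν).reachSet i)
      (reach A B (cube m) {0} (i * Δt))) atTop (𝓝 0))
    (yhat ζ : Vec n) (hζ : ζ ∈ normalCone (reach A B (cube m) {0} (i * Δt)) yhat)
    (hζ0 : ζ ≠ 0)
    (η : ℝ → Vec n) (hη : IsAdjoint (-A) (i * Δt) ζ η) :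
    (IsAdmissible (cube m) (signControl (-B) η) ∧
      (∃ y, IsTrajectory (-A) (-B) (signControl (-B) η) 0 (i * Δt) y ∧ y (i * Δt) = yhat) ∧
      minTime A B (cube m) {0} yhat = ENNReal.ofReal (i * Δt)) ∧
    (∃ yh ζh : ℕ → Vec n,
      (∀ᶠ ν in atTop, ζh ν ∈ normalCone ((D ν).reachSet i) (yh ν)) ∧
      Tendsto (fun ν => (yh ν, ζh ν)) atTop (𝓝 (yhat, ζ))) ∧
    ∀ yh ζh : ℕ → Vec n,
      (∀ᶠ ν in atTop, ζh ν ∈ normalCone ((D ν).reachSet i) (yh ν)) →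
      Tendsto (fun ν => (yh ν, ζh ν)) atTop (𝓝 (yhat, ζ)) →
      ∀ ηh : ℕ → ℕ → ℕ → Vec n, (∀ ν, (D ν).IsAdjoint i (ζh ν) (ηh ν)) →
      ∀ uh : ℕ → ℝ → Vec m, (∀ ν, (D ν).IsSignControl (-B) Δt i (ηh ν) (uh ν)) →
        (∀ ν, IntervalIntegrable (fun t => norm1 (signControl (-B) η t - uh ν t))
          MeasureTheory.volume 0 (i * Δt)) ∧
        Tendsto (fun ν => ∫ t in (0 : ℝ)..(i * Δt), norm1 (signControl (-B) η t - uh ν t))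
          atTop (𝓝 0) := by
  have hK' : (0 : ℝ) < K := by exact_mod_cast hK
  have hΔt0 : 0 < Δt := by rw [hΔt]; positivity
  have hT : 0 ≤ i * Δt := by positivity
  have hTf : i * Δt ≤ tf := by
    have h1 : (K : ℝ) * Δt = tf := by rw [hΔt]; field_simp
    have h2 : (i : ℝ) ≤ K := by exact_mod_cast hiK
    rw [← h1]; gcongr
  have hadm : IsAdmissible (cube m) (signControl (-B) η) :=
    isAdmissible_signControl (-B) hη.continuous
  refine ⟨⟨hadm, exists_trajectory_signControl hnormal hT hζ hζ0 hη,
    minTime_eq hT hTf hexp hζ hζ0⟩, ?_, ?_⟩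
  · refine exists_tendsto_normalCone (fun ν => ?_) (fun ν => convex_convexHull ℝ _) hconv hζ
    -- Writing `i` as `k + 1` makes the set the hull of a finite selection made at step `k`.
    obtain ⟨k, rfl⟩ := Nat.exists_eq_add_of_le' hi
    exact Discretization.isCompact_reachSet (hrun ν) hiK
  · intro yh ζh _ htend ηh hηh uh huh
    have hζh : Tendsto ζh atTop (𝓝 ζ) := htend.snd_nhds
    have hh : Tendsto (fun ν => (D ν).h Δt) atTop (𝓝 0) :=
      (tendsto_const_div_atTop_nhds_zero_nat Δt).comp hN
    have hε : Tendsto (fun ν => C * (D ν).h Δt ^ p) atTop (𝓝 0) := by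
      have := (hh.rpow_const (Or.inr hp.le)).const_mul C
      rwa [Real.zero_rpow hp.ne', mul_zero] at this
    obtain ⟨e, he, hb⟩ :=
      Discretization.exists_adjoint_error hΔt0 hi hiK hε hsolver hη hζh hηh
    have hmeas : ∀ ν, MeasureTheory.AEStronglyMeasurable (fun t => norm1 (signControl (-B) η t - uh ν t))
        (MeasureTheory.volume.restrict (uIoc 0 (i * Δt))) := fun ν => by
      rw [uIoc_of_le hT]
      exact continuous_norm1.comp_aestronglyMeasurable
        (hadm.1.aestronglyMeasurable.sub ((huh ν).aestronglyMeasurable hΔt0))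
    have hne : ∀ᵐ t : ℝ, t ≠ i * Δt := by simp [MeasureTheory.ae_iff]
    have hIco : ∀ {t : ℝ}, t ≠ i * Δt → t ∈ uIoc 0 (i * Δt) → t ∈ Ico 0 (i * Δt) :=
      fun h1 h2 => by
        rw [uIoc_of_le hT] at h2
        exact ⟨h2.1.le, lt_of_le_of_ne h2.2 h1⟩
    have hbound : ∀ ν, ∀ᵐ t, t ∈ uIoc 0 (i * Δt) →
        ‖norm1 (signControl (-B) η t - uh ν t)‖ ≤ 2 * m := fun ν => by
      filter_upwards [hne] with t h1 h2
      rw [Real.norm_of_nonneg (norm1_nonneg _), (huh ν).eq_on_Ico hΔt0 (hIco h1 h2)]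
      exact norm1_sub_le_of_mem_cube (hadm.2 t) (signVec_mem_cube _)
    refine ⟨fun ν => (intervalIntegrable_const (c := 2 * (m : ℝ))).mono_fun' (hmeas ν)
      ((MeasureTheory.ae_restrict_iff' measurableSet_uIoc).2 (hbound ν)), ?_⟩
    have hlim : ∀ᵐ t, t ∈ uIoc 0 (i * Δt) →
        Tendsto (fun ν => norm1 (signControl (-B) η t - uh ν t)) atTop (𝓝 0) := by
      filter_upwards [hne, hnormal.ae_switching_ne_zero hζ0 hη] with t h1 hsw h2
      have ht := hIco h1 h2
      have hconvη : Tendsto (fun ν => ηh ν ((D ν).index Δt t / (D ν).N)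
          ((D ν).index Δt t % (D ν).N)) atTop (𝓝 (η t)) := by
        have hg := (hη.continuous.tendsto t).comp
          (Discretization.tendsto_grid_index hN hΔt0 ht)
        have hd := squeeze_zero_norm (fun ν => hb ν _ ((D ν).index_spec hΔt0 ht).1 _
          ((D ν).index_spec hΔt0 ht).2.1.le) he
        simpa using hd.add hg
      have hsign := (((continuous_rowMul (-B)).tendsto (η t)).comp hconvη).eventually
        (eventually_signVec_eq hsw)
      -- The integrand is not merely small but exactly zero for large `ν`.
      refine tendsto_const_nhds.congr' ?_
      filter_upwards [hsign] with ν hν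
      rw [(huh ν).eq_on_Ico hΔt0 ht]
      simp only [Function.comp_apply] at hν
      rw [hν, signControl, sub_self]
      simp [norm1]
    have := intervalIntegral.tendsto_integral_filter_of_dominated_convergence
      (fun _ => 2 * (m : ℝ)) (Eventually.of_forall hmeas) (Eventually.of_forall hbound)
      intervalIntegrable_const hlim
    simpa using this
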